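/- Let $n\ge 1$ be odd, $\hat n=\frac{n-1}{2}$, and define the normalized weights $$w_k=\int_{-1/2}^{1/2}\ \prod_{\substack{i=-\hat n\\ i\ne k}}^{\hat n}\frac{u-i}{k-i}\,du ,\qquad k=-\hat n,\dots,\hat n .$$ For $h>0$ and $c\in\mathbb R$, the simple $n$-point rule with step $h$ and centre $c$, which approximates $\int_{c-h/2}^{c+h/2}f(x)\,dx$, is $L_{n}^{h,c}(f)=h\sum_{k=-\hat n}^{\hat n}w_k f(c+kh)$. Define $$\hat R_n=\frac{1}{h^{n+2}}\left[L_n^{h,0}\!\left(\frac{x^{n+1}}{(n+1)!}\right)-\int_{-h/2}^{h/2}\frac{x^{n+1}}{(n+1)!}\,dx\right].$$ Let $a<b$, let $N\ge n$ be an integer, and put $M=N-(n-1)$ and $h=(b-a)/M$. The $N$-point composite rule $L_N$ is obtained by applying the simple rule with step $h$ on each of the $M$ subintervals $[a+ih,a+(i+1)h]$, $0\le i<M$: $$L_N(f)=\sum_{i=0}^{M-1}L_n^{h,\,a+(i+1/2)h}(f),\qquad R_N=L_N(f)-\int_a^b f(x)\,dx .$$ Let $J=[a-(n-2)h/2,\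 b+(n-2)h/2]$ if $n\ge 3$ and $J=[a,b]$ if $n=1$. If $f$ is $n+1$ times continuously differentiable on $J$ (with one-sided derivatives at the endpoints of $J$), then there is $\xi\in J$ such that $$R_N=\hat R_n\,\frac{(b-a)^{n+2}f^{(n+1)}(\xi)}{[N-(n-1)]^{n+1}} .$$ Here $\hat R_n$ may be computed with any step $h>0$ in its definition, not only with $h=(b-a)/M$. -/

import Mathlib

namespace OverlapQuadrature

/-- The half-width `(n - 1) / 2` of the `n` point rule, for odd `n`. -/
def half (n : ℕ) : ℕ := (n - 1) / 2

/-- The index set `{-(n - 1) / 2, …, (n - 1) / 2}` of the `n` point rule, for odd `n`. -/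
noncomputable def nodes (n : ℕ) : Finset ℤ := Finset.Icc (-(half n : ℤ)) (half n : ℤ)

/-- The normalized weight of the node `k`: the integral over `[-1/2, 1/2]` of the Lagrange basis
polynomial of the node `k` relative to the nodes `-(n - 1) / 2, …, (n - 1) / 2`. -/
noncomputable def weight (n : ℕ) (k : ℤ) : ℝ :=
  ∫ u in (-1 / 2 : ℝ)..(1 / 2), ∏ i ∈ (nodes n).erase k, (u - (i : ℝ)) / ((k : ℝ) - (i : ℝ))

/-- The simple `n` point rule with step `h` and centre `c`. It approximates the integral over
`[c - h / 2, c + h / 2]` and evaluates the integrand at `c + k * h`, `|k| ≤ (n - 1) / 2`. -/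
noncomputable def simpleRule (n : ℕ) (h c : ℝ) (f : ℝ → ℝ) : ℝ :=
  h * ∑ k ∈ nodes n, weight n k * f (c + (k : ℝ) * h)

/-- The error, rule minus integral, of the simple `n` point rule on `[-h / 2, h / 2]`. -/
noncomputable def simpleError (n : ℕ) (h : ℝ) (f : ℝ → ℝ) : ℝ :=
  simpleRule n h 0 f - ∫ x in (-h / 2)..(h / 2), f x

/-- The normalized integration error of the `n` point rule, computed with the step `h`. -/
noncomputable def normalizedError (n : ℕ) (h : ℝ) : ℝ :=
  simpleError n h (fun x => x ^ (n + 1) / ((n + 1).factorial : ℝ)) / h ^ (n + 2)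

/-- The step `(b - a) / M` of the `N` point composite rule, where `M = N - (n - 1)`. -/
noncomputable def step (n N : ℕ) (a b : ℝ) : ℝ := (b - a) / ((N : ℝ) - ((n : ℝ) - 1))

/-- The `N` point composite rule on `[a, b]`: the simple `n` point rule is applied on each of the
`M = N - (n - 1)` subintervals `[a + i * h, a + (i + 1) * h]`, `i = 0, …, M - 1`. -/
noncomputable def compositeRule (n N : ℕ) (a b : ℝ) (f : ℝ → ℝ) : ℝ :=
  ∑ i ∈ Finset.range (N - (n - 1)),
    simpleRule n (step n N a b) (a + ((i : ℝ) + 1 / 2) * step n N a b) f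

/-- The error, rule minus integral, of the `N` point composite rule on `[a, b]`. -/
noncomputable def compositeError (n N : ℕ) (a b : ℝ) (f : ℝ → ℝ) : ℝ :=
  compositeRule n N a b f - ∫ x in a..b, f x

/-- The interval `[a - (n - 2) * h / 2, b + (n - 2) * h / 2]` spanned by the evaluation points of
the composite rule when `3 ≤ n`; it is `[a, b]` when `n = 1` (the composite midpoint rule). -/
noncomputable def hull (n N : ℕ) (a b : ℝ) : Set ℝ :=
  Set.Icc (a - max ((n : ℝ) - 2) 0 * step n N a b / 2)
    (b + max ((n : ℝ) - 2) 0 * step n N a b / 2)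

end OverlapQuadrature

/-!
The error of the simple rule is minus the integral of `f - p` over one cell, where `p` interpolates
`f` at the `n` nodes. Since the nodes and the cell are symmetric about the centre, this integral
may be folded to one half of the cell. The folded integrand, the sum of the interpolation errors at
`u` and `-u` in units of the step, equals `2 * u * ω u * h ^ (n + 1) / (n + 1)!` times a value of
the derivative of `f` of order `n + 1`, where `ω` is the nodal polynomial
(`exists_interpError_add_interpError_neg`): interpolate at the nodes and at `±u`, apply Rolle's
theorem repeatedly, and use that `ω` is odd. This gains one order over the usual remainder
of the interpolating polynomial.

The cell is the central one, and no node other than the centre lies inside it, so `u * ω u` has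
constant sign on `(0, 1 / 2)`. Hence the simple rule errs by a constant times `h ^ (n + 2)` times a
number between any two bounds of the derivative (`exists_simpleRule_sub_integral_eq`). Taking
`f x = x ^ (n + 1) / (n + 1)!` identifies the constant as the normalized error
(`normalizedError_eq`). In the composite rule these numbers are averaged over the subintervals; the
average lies between the extreme values of the continuous derivative of order `n + 1`, so it is one
of its values.
-/

namespace OverlapQuadrature

open Polynomial Set intervalIntegral

/-! ### Rolle's theorem for higher derivatives -/

theorem exists_iteratedDerivWithin_eq_zero {α β : ℝ} (k : ℕ) (f : ℝ → ℝ)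
    (hf : ContDiffOn ℝ k f (Icc α β)) (x : Fin (k + 1) → ℝ) (hx : StrictMono x)
    (hmem : ∀ i, x i ∈ Icc α β) (hzero : ∀ i, f (x i) = 0) :
    ∃ ξ ∈ Icc α β, iteratedDerivWithin k f (Icc α β) ξ = 0 := by
  induction k generalizing f with
  | zero => exact ⟨x 0, hmem 0, by simpa using hzero 0⟩
  | succ k ih =>
    have hαβ : α < β :=
      (hmem 0).1.trans_lt ((hx (Fin.succ_pos (0 : Fin (k + 1)))).trans_le (hmem _).2)
    have hud : UniqueDiffOn ℝ (Icc α β) := uniqueDiffOn_Icc hαβ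
    have hrolle : ∀ i : Fin (k + 1), ∃ y ∈ Ioo (x i.castSucc) (x i.succ), deriv f y = 0 := by
      intro i
      refine exists_deriv_eq_zero (hx Fin.castSucc_lt_succ) ?_ (by rw [hzero, hzero])
      exact hf.continuousOn.mono (Icc_subset_Icc (hmem _).1 (hmem _).2)
    choose y hy hdy using hrolle
    have hyI : ∀ i, y i ∈ Ioo α β := fun i =>
      ⟨(hmem _).1.trans_lt (hy i).1, (hy i).2.trans_le (hmem _).2⟩
    have hymono : StrictMono y := by
      rw [Fin.strictMono_iff_lt_succ]
      intro i
      have h1 := (hy i.castSucc).2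
      have h2 := (hy i.succ).1
      rw [Fin.succ_castSucc] at h1
      exact h1.trans h2
    obtain ⟨ξ, hξ, h0⟩ := ih (derivWithin f (Icc α β))
      (hf.derivWithin hud (by norm_cast)) y hymono (fun i => Ioo_subset_Icc_self (hyI i))
      (fun i => by
        rw [derivWithin_of_mem_nhds (Icc_mem_nhds (hyI i).1 (hyI i).2), hdy i])
    exact ⟨ξ, hξ, by rw [iteratedDerivWithin_succ', h0]⟩

theorem iteratedDerivWithin_polynomial_eval {s : Set ℝ} (hs : UniqueDiffOn ℝ s) (k : ℕ)
    (P : ℝ[X]) {x : ℝ} (hx : x ∈ s) :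
    iteratedDerivWithin k (fun t => P.eval t) s x = (derivative^[k] P).eval x := by
  induction k generalizing x with
  | zero => simp
  | succ k ih =>
    rw [iteratedDerivWithin_succ, derivWithin_congr (fun t ht => ih ht) (ih hx),
      Polynomial.derivWithin _ (hs x hx), Function.iterate_succ_apply']

/-- A divided difference over `k + 1` points is a value of the `k`-th derivative divided by `k!`;
the divided difference enters as the top coefficient of an interpolating polynomial. -/
theorem exists_iteratedDerivWithin_eq_factorial_mul_coeff {α β : ℝ} (hαβ : α < β) {k : ℕ}
    {f : ℝ → ℝ} (hf : ContDiffOn ℝ k f (Icc α β)) {s : Finset ℝ} (hs : s.card = k + 1)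
    (hsub : ∀ x ∈ s, x ∈ Icc α β) {P : ℝ[X]} (hP : P.natDegree ≤ k)
    (heq : ∀ x ∈ s, P.eval x = f x) :
    ∃ ξ ∈ Icc α β, iteratedDerivWithin k f (Icc α β) ξ = k.factorial * P.coeff k := by
  have hud : UniqueDiffOn ℝ (Icc α β) := uniqueDiffOn_Icc hαβ
  have hPc : ContDiff ℝ k (fun t => P.eval t) := by
    simpa using P.contDiff_aeval (𝕜 := ℝ) (k : WithTop ℕ∞)
  obtain ⟨ξ, hξ, h0⟩ := exists_iteratedDerivWithin_eq_zero k (f - fun t => P.eval t)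
    (hf.sub hPc.contDiffOn) (s.orderEmbOfFin hs) (s.orderEmbOfFin hs).strictMono
    (fun i => hsub _ (s.orderEmbOfFin_mem hs i))
    (fun i => by simp [heq _ (s.orderEmbOfFin_mem hs i)])
  refine ⟨ξ, hξ, ?_⟩
  rw [iteratedDerivWithin_sub hξ hud (hf ξ hξ) hPc.contDiffWithinAt,
    iteratedDerivWithin_polynomial_eval hud k P hξ, sub_eq_zero] at h0
  rw [h0]
  have hdeg : (derivative^[k] P).natDegree = 0 := by
    have := natDegree_iterate_derivative P k
    omega
  rw [eq_C_of_natDegree_eq_zero hdeg, eval_C, coeff_iterate_derivative, zero_add,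
    Nat.descFactorial_self, nsmul_eq_mul]

/-! ### The interpolation error on a symmetric set of nodes -/

/-- The nodal polynomial `∏ (u - i)` of the `n` point rule with step `1` and centre `0`. -/
noncomputable def nodalFn (n : ℕ) (u : ℝ) : ℝ := ∏ i ∈ nodes n, (u - (i : ℝ))

/-- The value at `u` of the Lagrange basis polynomial of the node `k`. -/
noncomputable def basisFn (n : ℕ) (k : ℤ) (u : ℝ) : ℝ :=
  ∏ i ∈ (nodes n).erase k, (u - (i : ℝ)) / ((k : ℝ) - (i : ℝ))

/-- The error at `c + u * h` of the polynomial interpolating `f` at the points `c + k * h`. -/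
noncomputable def interpError (n : ℕ) (h c : ℝ) (f : ℝ → ℝ) (u : ℝ) : ℝ :=
  f (c + u * h) - ∑ k ∈ nodes n, f (c + (k : ℝ) * h) * basisFn n k u

/-- The integral of `2 * u * nodalFn n u` over `[0, 1 / 2]`, divided by `(n + 1)!`. It is the
negative of the normalized error. -/
noncomputable def errorConst (n : ℕ) : ℝ :=
  (∫ u in (0 : ℝ)..(1 / 2), 2 * u * nodalFn n u) / ((n + 1).factorial : ℝ)

theorem card_nodes {n : ℕ} (hn : Odd n) : (nodes n).card = n := by
  obtain ⟨m, rfl⟩ := hn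
  simp only [nodes, half, Int.card_Icc]
  omega

theorem nodalFn_eq_mul_prod_sq (n : ℕ) (u : ℝ) :
    nodalFn n u = u * ∏ j ∈ Finset.range (half n), (u ^ 2 - ((j : ℝ) + 1) ^ 2) := by
  unfold nodalFn nodes
  induction half n with
  | zero => simp
  | succ m ih =>
    have hset : Finset.Icc (-((m + 1 : ℕ) : ℤ)) ((m + 1 : ℕ) : ℤ) =
        insert (-((m : ℤ) + 1)) (insert ((m : ℤ) + 1) (Finset.Icc (-(m : ℤ)) (m : ℤ))) := by
      ext i
      simp only [Finset.mem_Icc, Finset.mem_insert]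
      push_cast
      omega
    rw [hset, Finset.prod_insert, Finset.prod_insert, ih, Finset.prod_range_succ]
    · push_cast
      ring
    · simp
    · simp only [Finset.mem_insert, Finset.mem_Icc]
      omega

theorem nodalFn_neg (n : ℕ) (u : ℝ) : nodalFn n (-u) = -nodalFn n u := by
  simp [nodalFn_eq_mul_prod_sq]

theorem continuous_nodalFn (n : ℕ) : Continuous (nodalFn n) := by
  unfold nodalFn
  fun_prop

theorem continuous_basisFn (n : ℕ) (k : ℤ) : Continuous (basisFn n k) := by
  unfold basisFn
  fun_prop

/-- On `(0, 1 / 2)` the nodal polynomial has constant sign: no node lies there. -/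
theorem neg_one_pow_mul_nodalFn_pos (n : ℕ) {u : ℝ} (hu : u ∈ Ioo (0 : ℝ) (1 / 2)) :
    0 < (-1) ^ half n * (2 * u * nodalFn n u) := by
  have hprod : (-1 : ℝ) ^ half n * ∏ j ∈ Finset.range (half n), (u ^ 2 - ((j : ℝ) + 1) ^ 2) =
      ∏ j ∈ Finset.range (half n), (((j : ℝ) + 1) ^ 2 - u ^ 2) := by
    conv_lhs => rw [← Finset.card_range (half n), ← Finset.prod_const, Finset.card_range]
    rw [← Finset.prod_mul_distrib]
    exact Finset.prod_congr rfl fun j _ => by ring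
  have hpos : 0 < ∏ j ∈ Finset.range (half n), (((j : ℝ) + 1) ^ 2 - u ^ 2) := by
    refine Finset.prod_pos fun j _ => ?_
    have hj : (0 : ℝ) ≤ j := j.cast_nonneg
    nlinarith [hu.1, hu.2]
  have : (-1) ^ half n * (2 * u * nodalFn n u) =
      2 * u ^ 2 * ∏ j ∈ Finset.range (half n), (((j : ℝ) + 1) ^ 2 - u ^ 2) := by
    rw [← hprod, nodalFn_eq_mul_prod_sq]
    ring
  rw [this]
  have := hu.1
  positivity

/-- The errors at `u` and `-u` add up to a single value of the derivative of order `n + 1`, one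
more than the `n` nodes alone would give: interpolating `f` at the nodes and at `±u` adds
`ω * (p * X + q)` to the interpolating polynomial, with `ω` the nodal polynomial, and the part
with `q` cancels because `ω` is odd about the centre. -/
theorem exists_interpError_add_interpError_neg {n : ℕ} (hn : Odd n) {α β h c : ℝ} (hh : 0 < h)
    {f : ℝ → ℝ} (hf : ContDiffOn ℝ ((n + 1 : ℕ) : WithTop ℕ∞) f (Icc α β))
    (hnodes : ∀ k ∈ nodes n, c + (k : ℝ) * h ∈ Icc α β)
    (hcell : Icc (c - h / 2) (c + h / 2) ⊆ Icc α β) {u : ℝ} (hu : u ∈ Ioo (0 : ℝ) (1 / 2)) :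
    ∃ ξ ∈ Icc α β, interpError n h c f u + interpError n h c f (-u) =
      2 * u * nodalFn n u * (h ^ (n + 1) / ((n + 1).factorial : ℝ)) *
        iteratedDerivWithin (n + 1) f (Icc α β) ξ := by
  have hαβ : α < β := by
    have h1 := (hcell ⟨le_refl _, by linarith⟩).1
    have h2 := (hcell ⟨by linarith, le_refl _⟩).2
    linarith
  set v : ℤ → ℝ := fun k => c + (k : ℝ) * h with hv
  have hvinj : Function.Injective v := by
    intro i j hij
    have : (i : ℝ) * h = j * h := by simpa [hv] using hij
    exact_mod_cast mul_right_cancel₀ hh.ne' this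
  have hω0 : nodalFn n u ≠ 0 := by
    intro h0
    have := neg_one_pow_mul_nodalFn_pos n hu
    simp [h0] at this
  have hu0 : u ≠ 0 := hu.1.ne'
  have hhn : h ≠ 0 := hh.ne'
  set e := interpError n h c f with he
  set I := Lagrange.interpolate (nodes n) v (fun k => f (v k)) with hI
  set W := Lagrange.nodal (nodes n) v with hW
  have hWeval : ∀ t : ℝ, W.eval (c + t * h) = h ^ n * nodalFn n t := by
    intro t
    rw [hW, Lagrange.eval_nodal, nodalFn]
    conv_rhs => rw [← card_nodes hn, ← Finset.prod_const, card_nodes hn]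
    rw [← Finset.prod_mul_distrib]
    exact Finset.prod_congr rfl fun i _ => by simp only [hv]; ring
  have hIeval : ∀ t : ℝ, I.eval (c + t * h) = f (c + t * h) - e t := by
    intro t
    rw [hI, he, interpError, sub_sub_cancel, Lagrange.interpolate_apply, eval_finsetSum]
    refine Finset.sum_congr rfl fun k _ => ?_
    rw [eval_mul, eval_C, Lagrange.basis, eval_prod, basisFn]
    congr 1
    refine Finset.prod_congr rfl fun i hi => ?_
    have hne : (k : ℝ) - i ≠ 0 := by
      rw [sub_ne_zero]
      exact_mod_cast (Finset.ne_of_mem_erase hi).symm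
    have hd : v k - v i = (k - i) * h := by simp only [hv]; ring
    rw [Lagrange.basisDivisor, hd]
    simp only [eval_mul, eval_C, eval_sub, eval_X, hv]
    field_simp
    ring
  -- The values of `p` and `q` for which `P` agrees with `f` at `c + u * h` and `c - u * h`.
  set p : ℝ := (e u + e (-u)) / (2 * u * h * (h ^ n * nodalFn n u)) with hp
  set q : ℝ := (e u - e (-u)) / (2 * (h ^ n * nodalFn n u)) - p * c with hq
  set P : ℝ[X] := I + W * (C p * X + C q) with hPdef
  have hPeval : ∀ t : ℝ, P.eval (c + t * h) =
      f (c + t * h) - e t + h ^ n * nodalFn n t * (p * (c + t * h) + q) := by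
    intro t
    simp only [hPdef, eval_add, eval_mul, eval_C, eval_X, hIeval, hWeval]
  have hIdeg : I.degree < (n : ℕ) := by
    have := Lagrange.degree_interpolate_lt (s := nodes n) (v := v) (fun k => f (v k))
      hvinj.injOn
    rwa [card_nodes hn] at this
  have hWdeg : W.natDegree = n := by rw [hW, Lagrange.natDegree_nodal, card_nodes hn]
  have hWcoeff : W.coeff n = 1 := by
    have : W.Monic := Lagrange.nodal_monic
    rw [← hWdeg]
    exact this
  have hPdeg : P.natDegree ≤ n + 1 := by
    refine (natDegree_add_le _ _).trans (max_le ?_ ?_)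
    · exact (natDegree_le_of_degree_le hIdeg.le).trans (Nat.le_succ n)
    · refine natDegree_mul_le.trans ?_
      rw [hWdeg]
      have := natDegree_linear_le (a := p) (b := q)
      omega
  have hPcoeff : P.coeff (n + 1) = p := by
    have h1 : I.coeff (n + 1) = 0 :=
      coeff_eq_zero_of_degree_lt (hIdeg.trans (by exact_mod_cast Nat.lt_succ_self n))
    have h2 : W.coeff (n + 1) = 0 := coeff_eq_zero_of_natDegree_lt (by omega)
    have h3 : W * (C p * X + C q) = C p * (W * X) + C q * W := by ring
    rw [hPdef, coeff_add, h1, h3, coeff_add, coeff_C_mul, coeff_C_mul, coeff_mul_X, h2, hWcoeff]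
    ring
  -- The `n + 2` interpolation points.
  set s : Finset ℝ := insert (c + u * h) (insert (c + -u * h) ((nodes n).image v)) with hs
  have hnot : ∀ t : ℝ, nodalFn n t ≠ 0 → c + t * h ∉ (nodes n).image v := by
    intro t ht hmem
    obtain ⟨i, hi, hit⟩ := Finset.mem_image.1 hmem
    have := Lagrange.eval_nodal_at_node (v := v) hi
    rw [hit, ← hW, hWeval] at this
    exact mul_ne_zero (pow_ne_zero _ hhn) ht this
  have hscard : s.card = n + 1 + 1 := by
    rw [hs, Finset.card_insert_of_notMem, Finset.card_insert_of_notMem,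
      Finset.card_image_of_injective _ hvinj, card_nodes hn]
    · exact hnot _ (by rw [nodalFn_neg]; exact neg_ne_zero.2 hω0)
    · rw [Finset.mem_insert, not_or]
      refine ⟨fun h0 => ?_, hnot _ hω0⟩
      have := mul_pos hu.1 hh
      linarith
  have huh : u * h ≤ h / 2 := by nlinarith [hu.2]
  have huh' : 0 < u * h := mul_pos hu.1 hh
  obtain ⟨ξ, hξ, hval⟩ := exists_iteratedDerivWithin_eq_factorial_mul_coeff hαβ hf hscard
    (P := P) (by
      intro x hx
      rw [hs, Finset.mem_insert, Finset.mem_insert, Finset.mem_image] at hx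
      rcases hx with rfl | rfl | ⟨k, hk, rfl⟩
      · exact hcell ⟨by linarith, by linarith⟩
      · exact hcell ⟨by linarith, by linarith⟩
      · exact hnodes k hk) hPdeg (by
      intro x hx
      rw [hs, Finset.mem_insert, Finset.mem_insert, Finset.mem_image] at hx
      rcases hx with rfl | rfl | ⟨k, hk, rfl⟩
      · rw [hPeval, hq, hp]
        field_simp
        ring
      · rw [hPeval, nodalFn_neg, hq, hp]
        field_simp
        ring
      · rw [hPdef, eval_add, eval_mul, hW, Lagrange.eval_nodal_at_node hk, zero_mul, add_zero,
          hI, Lagrange.eval_interpolate_at_node _ hvinj.injOn hk])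
  refine ⟨ξ, hξ, ?_⟩
  rw [hval, hPcoeff, hp]
  have : ((n + 1).factorial : ℝ) ≠ 0 := by positivity
  field_simp
  ring

/-! ### The error of the simple rule -/

/-- A mean value theorem for integrals of a quotient `F / φ` that is bounded but not assumed
continuous; the mean value lies between the bounds. -/
theorem exists_mem_Icc_integral_eq_mul {a b A B : ℝ} (hab : a < b) {F φ : ℝ → ℝ}
    (hF : ContinuousOn F (Icc a b)) (hφ : ContinuousOn φ (Icc a b))
    (hpos : ∀ u ∈ Ioo a b, 0 < φ u)
    (hmul : ∀ u ∈ Ioo a b, ∃ y ∈ Icc A B, F u = φ u * y) :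
    ∃ y ∈ Icc A B, ∫ u in a..b, F u = (∫ u in a..b, φ u) * y := by
  have hFi : IntervalIntegrable F MeasureTheory.volume a b :=
    hF.intervalIntegrable_of_Icc hab.le
  have hφi : IntervalIntegrable φ MeasureTheory.volume a b :=
    hφ.intervalIntegrable_of_Icc hab.le
  have hI : 0 < ∫ u in a..b, φ u := intervalIntegral_pos_of_pos_on hφi hpos hab
  refine ⟨(∫ u in a..b, F u) / ∫ u in a..b, φ u, ⟨?_, ?_⟩, by field_simp⟩
  · rw [le_div_iff₀ hI, ← intervalIntegral.integral_const_mul]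
    refine integral_mono_on_of_le_Ioo hab.le (hφi.const_mul A) hFi fun u hu => ?_
    obtain ⟨y, hy, hFu⟩ := hmul u hu
    rw [hFu, mul_comm]
    exact mul_le_mul_of_nonneg_left hy.1 (hpos u hu).le
  · rw [div_le_iff₀ hI, ← intervalIntegral.integral_const_mul]
    refine integral_mono_on_of_le_Ioo hab.le hFi (hφi.const_mul B) fun u hu => ?_
    obtain ⟨y, hy, hFu⟩ := hmul u hu
    rw [hFu, mul_comm B]
    exact mul_le_mul_of_nonneg_left hy.2 (hpos u hu).le

theorem continuousOn_interpError {n : ℕ} {h c : ℝ} (hh : 0 < h) {f : ℝ → ℝ}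
    (hf : ContinuousOn f (Icc (c - h / 2) (c + h / 2))) :
    ContinuousOn (interpError n h c f) (Icc (-1 / 2) (1 / 2)) := by
  refine ContinuousOn.sub (hf.comp (by fun_prop) fun u hu => ⟨?_, ?_⟩) ?_
  · nlinarith [hu.1]
  · nlinarith [hu.2]
  · exact (continuous_finsetSum _ fun k _ =>
      continuous_const.mul (continuous_basisFn n k)).continuousOn

theorem simpleRule_sub_integral_eq {n : ℕ} {h c : ℝ} (hh : 0 < h) {f : ℝ → ℝ}
    (hf : ContinuousOn f (Icc (c - h / 2) (c + h / 2))) :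
    simpleRule n h c f - ∫ x in (c - h / 2)..(c + h / 2), f x =
      -h * ∫ u in (0 : ℝ)..(1 / 2), (interpError n h c f u + interpError n h c f (-u)) := by
  have hcont := continuousOn_interpError (n := n) hh hf
  have hle : (-1 / 2 : ℝ) ≤ 1 / 2 := by norm_num
  have hint : IntervalIntegrable (interpError n h c f) MeasureTheory.volume (-1 / 2) (1 / 2) :=
    hcont.intervalIntegrable_of_Icc hle
  have hbi : ∀ k ∈ nodes n, IntervalIntegrable
      (fun u => f (c + (k : ℝ) * h) * basisFn n k u) MeasureTheory.volume (-1 / 2) (1 / 2) :=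
    fun k _ => (continuous_const.mul (continuous_basisFn n k)).intervalIntegrable _ _
  have hfi : IntervalIntegrable (fun u => f (c + u * h)) MeasureTheory.volume
      (-1 / 2) (1 / 2) := by
    refine ContinuousOn.intervalIntegrable_of_Icc hle
      (hf.comp (by fun_prop) fun u hu => ⟨?_, ?_⟩)
    · nlinarith [hu.1]
    · nlinarith [hu.2]
  -- The whole error is `-h` times the integral of the interpolation error over `[-1/2, 1/2]`.
  have h1 : simpleRule n h c f - ∫ x in (c - h / 2)..(c + h / 2), f x =
      -h * ∫ u in (-1 / 2 : ℝ)..(1 / 2), interpError n h c f u := by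
    have hsub : h * ∫ u in (-1 / 2 : ℝ)..(1 / 2), f (c + u * h) =
        ∫ x in (c - h / 2)..(c + h / 2), f x := by
      have := intervalIntegral.mul_integral_comp_add_mul (a := -1 / 2) (b := 1 / 2) (f := f) h c
      simp only [fun u : ℝ => mul_comm u h]
      rw [this]
      congr 1 <;> ring
    unfold interpError
    rw [intervalIntegral.integral_sub hfi (by
      simpa only [Finset.sum_fn] using IntervalIntegrable.sum _ hbi),
      intervalIntegral.integral_finsetSum hbi, mul_sub, neg_mul, hsub, simpleRule]
    simp only [intervalIntegral.integral_const_mul, weight, basisFn]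
    simp only [mul_comm (f _)]
    ring
  have hm : IntervalIntegrable (interpError n h c f) MeasureTheory.volume (-1 / 2) 0 :=
    hint.mono_set (by
      rw [uIcc_of_le (by norm_num), uIcc_of_le hle]
      exact Icc_subset_Icc_right (by norm_num))
  have hp : IntervalIntegrable (interpError n h c f) MeasureTheory.volume 0 (1 / 2) :=
    hint.mono_set (by
      rw [uIcc_of_le (by norm_num), uIcc_of_le hle]
      exact Icc_subset_Icc_left (by norm_num))
  have hmn : IntervalIntegrable (fun u => interpError n h c f (-u)) MeasureTheory.volume
      0 (1 / 2) := by
    refine ContinuousOn.intervalIntegrable_of_Icc (by norm_num)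
      (hcont.comp (by fun_prop) fun u hu => ⟨?_, ?_⟩)
    · linarith [hu.2]
    · linarith [hu.1]
  rw [h1, ← integral_add_adjacent_intervals hm hp, intervalIntegral.integral_add hp hmn,
    intervalIntegral.integral_comp_neg, neg_zero, neg_div, add_comm]

/-- The simple rule errs by `-errorConst n * h ^ (n + 2)` times a number between any two bounds
of the derivative of order `n + 1`. -/
theorem exists_simpleRule_sub_integral_eq {n : ℕ} (hn : Odd n) {α β h c A B : ℝ} (hh : 0 < h)
    {f : ℝ → ℝ} (hf : ContDiffOn ℝ ((n + 1 : ℕ) : WithTop ℕ∞) f (Icc α β))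
    (hnodes : ∀ k ∈ nodes n, c + (k : ℝ) * h ∈ Icc α β)
    (hcell : Icc (c - h / 2) (c + h / 2) ⊆ Icc α β)
    (hbound : ∀ x ∈ Icc α β, iteratedDerivWithin (n + 1) f (Icc α β) x ∈ Icc A B) :
    ∃ y ∈ Icc A B, simpleRule n h c f - ∫ x in (c - h / 2)..(c + h / 2), f x =
      -errorConst n * h ^ (n + 2) * y := by
  have hfc := hf.continuousOn.mono hcell
  have hcont := continuousOn_interpError (n := n) hh hfc
  have hsgn : ((-1 : ℝ) ^ half n) * (-1) ^ half n = 1 := by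
    rw [← mul_pow]
    norm_num
  set K : ℝ := h ^ (n + 1) / ((n + 1).factorial : ℝ) with hK
  have hKpos : 0 < K := by positivity
  -- The factor `(-1) ^ half n` makes the weight `φ` positive.
  obtain ⟨y, hy, hint⟩ := exists_mem_Icc_integral_eq_mul (a := 0) (b := 1 / 2) (A := A) (B := B)
    (F := fun u => (-1) ^ half n * (interpError n h c f u + interpError n h c f (-u)))
    (φ := fun u => (-1) ^ half n * K * (2 * u * nodalFn n u)) (by norm_num)
    (continuousOn_const.mul ((hcont.mono (Icc_subset_Icc_left (by norm_num))).add
      (hcont.comp (by fun_prop) fun u hu => ⟨by linarith [hu.2], by linarith [hu.1]⟩)))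
    (by
      have := continuous_nodalFn n
      fun_prop)
    (fun u hu => by
      have := mul_pos hKpos (neg_one_pow_mul_nodalFn_pos n hu)
      linarith)
    (fun u hu => by
      obtain ⟨ξ, hξ, hval⟩ := exists_interpError_add_interpError_neg hn hh hf hnodes hcell hu
      exact ⟨_, hbound ξ hξ, by rw [hval, ← hK]; ring⟩)
  refine ⟨y, hy, ?_⟩
  rw [intervalIntegral.integral_const_mul, intervalIntegral.integral_const_mul] at hint
  have hE : ∫ u in (0 : ℝ)..(1 / 2), (interpError n h c f u + interpError n h c f (-u)) =
      K * (∫ u in (0 : ℝ)..(1 / 2), 2 * u * nodalFn n u) * y := by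
    linear_combination (-1) ^ half n * hint +
      (-(∫ u in (0 : ℝ)..(1 / 2), (interpError n h c f u + interpError n h c f (-u))) +
        K * (∫ u in (0 : ℝ)..(1 / 2), 2 * u * nodalFn n u) * y) * hsgn
  rw [simpleRule_sub_integral_eq hh hfc, hE, errorConst, hK]
  ring

theorem abs_le_half_of_mem_nodes {n : ℕ} (hn : Odd n) {k : ℤ} (hk : k ∈ nodes n) :
    |(k : ℝ)| ≤ ((n : ℝ) - 1) / 2 := by
  obtain ⟨m, rfl⟩ := hn
  have hm : half (2 * m + 1) = m := by
    unfold half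
    omega
  rw [nodes, hm, Finset.mem_Icc] at hk
  rw [abs_le]
  have h1 : -(m : ℝ) ≤ k := by exact_mod_cast hk.1
  have h2 : (k : ℝ) ≤ m := by exact_mod_cast hk.2
  push_cast
  constructor <;> linarith

/-- The derivative of order `n + 1` of `x ^ (n + 1) / (n + 1)!` is constantly `1`, which makes the
intermediate value in the error of the simple rule explicit. -/
theorem normalizedError_eq {n : ℕ} (hn : Odd n) {h : ℝ} (hh : 0 < h) :
    normalizedError n h = -errorConst n := by
  have hn0 : (0 : ℝ) ≤ n := n.cast_nonneg
  -- Any interval around the centre that holds the nodes and the cell will do.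
  have hr : (0 : ℝ) < (n + 1) * h := by positivity
  set P : ℝ[X] := C ((n + 1).factorial : ℝ)⁻¹ * X ^ (n + 1) with hP
  have hfP : (fun x : ℝ => x ^ (n + 1) / ((n + 1).factorial : ℝ)) = fun x => P.eval x := by
    funext x
    simp [hP, div_eq_inv_mul]
  have hfac : ((n + 1).factorial : ℝ) ≠ 0 := by positivity
  obtain ⟨y, hy, hval⟩ := exists_simpleRule_sub_integral_eq hn (α := -((n + 1) * h))
    (β := (n + 1) * h) (c := 0) (A := 1) (B := 1) hh
    (f := fun x => x ^ (n + 1) / ((n + 1).factorial : ℝ))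
    (by fun_prop)
    (fun k hk => by
      have h1 := abs_le.1 (abs_le_half_of_mem_nodes hn hk)
      constructor <;> nlinarith [h1.1, h1.2])
    (Icc_subset_Icc (by nlinarith) (by nlinarith))
    (fun x hx => by
      rw [hfP, iteratedDerivWithin_polynomial_eval (uniqueDiffOn_Icc (by linarith)) _ _ hx, hP,
        iterate_derivative_C_mul, iterate_derivative_X_pow_eq_C_mul, Nat.descFactorial_self]
      simp [hfac])
  obtain rfl : y = 1 := le_antisymm hy.2 hy.1
  rw [zero_sub, zero_add, mul_one, ← neg_div] at hval
  rw [normalizedError, simpleError, hval]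
  field_simp

/-! ### The composite rule -/

/-- The composite rule errs by the normalized error times `(b - a) * h ^ (n + 1)` times a number
between any two bounds of the derivative of order `n + 1`. -/
theorem exists_compositeError_eq {n N : ℕ} (hn : Odd n) (hN : n ≤ N) {a b A B : ℝ} (hab : a < b)
    {f : ℝ → ℝ} (hf : ContDiffOn ℝ ((n + 1 : ℕ) : WithTop ℕ∞) f (hull n N a b))
    (hbound : ∀ x ∈ hull n N a b,
      iteratedDerivWithin (n + 1) f (hull n N a b) x ∈ Icc A B) :
    ∃ y ∈ Icc A B, compositeError n N a b f =
      -errorConst n * ((b - a) ^ (n + 2) * y / ((N : ℝ) - ((n : ℝ) - 1)) ^ (n + 1)) := by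
  have hn1 : 1 ≤ n := hn.pos
  obtain ⟨M, hM⟩ : ∃ M, M = N - (n - 1) := ⟨_, rfl⟩
  have hM1 : 1 ≤ M := by omega
  have hMR : (N : ℝ) - ((n : ℝ) - 1) = M := by
    have : N + 1 = M + n := by omega
    have : (N : ℝ) + 1 = M + n := by exact_mod_cast this
    linarith
  have hMpos : (0 : ℝ) < M := by exact_mod_cast hM1
  set h : ℝ := step n N a b with hstep
  have hMh : M * h = b - a := by
    rw [hstep, step, hMR]
    field_simp
  have hh : 0 < h := by
    rw [hstep, step, hMR]
    exact div_pos (by linarith) hMpos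
  set D : ℝ := max ((n : ℝ) - 2) 0 * h / 2 with hD
  have hD0 : 0 ≤ D := by positivity
  -- The hull contains all evaluation points, which reach `(n - 2) * h / 2` beyond `[a, b]`.
  have hDn : ((n : ℝ) - 2) * h / 2 ≤ D := by
    rw [hD]
    gcongr
    exact le_max_left _ _
  rw [hull, ← hstep, ← hD] at hf hbound
  have herr : ∀ i ∈ Finset.range M, ∃ y ∈ Icc A B,
      simpleRule n h (a + ((i : ℝ) + 1 / 2) * h) f -
          ∫ x in (a + i * h)..(a + (i + 1 : ℕ) * h), f x =
        -errorConst n * h ^ (n + 2) * y := by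
    intro i hi
    have hi0 : 0 ≤ (i : ℝ) * h := by positivity
    have hiM : ((i : ℝ) + 1) * h ≤ b - a := by
      rw [← hMh]
      gcongr
      exact_mod_cast Finset.mem_range.1 hi
    obtain ⟨y, hy, hval⟩ := exists_simpleRule_sub_integral_eq hn
      (c := a + ((i : ℝ) + 1 / 2) * h) hh hf
      (fun k hk => by
        have h1 := abs_le.1 (abs_le_half_of_mem_nodes hn hk)
        have h2 := mul_le_mul_of_nonneg_right h1.1 hh.le
        have h3 := mul_le_mul_of_nonneg_right h1.2 hh.le
        constructor <;> linarith)
      (Icc_subset_Icc (by linarith) (by linarith)) hbound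
    refine ⟨y, hy, ?_⟩
    rw [← hval]
    congr 2
    · ring
    · push_cast
      ring
  have hsum : ∑ i ∈ Finset.range M, ∫ x in (a + i * h)..(a + (i + 1 : ℕ) * h), f x =
      ∫ x in a..b, f x := by
    rw [intervalIntegral.sum_integral_adjacent_intervals (a := fun i : ℕ => a + i * h)]
    · simp [hMh]
    · intro i hi
      have hi0 : 0 ≤ (i : ℝ) * h := by positivity
      have hiM : ((i + 1 : ℕ) : ℝ) * h ≤ b - a := by
        rw [← hMh]
        gcongr
        exact_mod_cast hi
      have hle : (i : ℝ) * h ≤ ((i + 1 : ℕ) : ℝ) * h := by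
        gcongr
        exact Nat.le_succ i
      refine (hf.continuousOn.mono (Icc_subset_Icc ?_ ?_)).intervalIntegrable_of_Icc ?_
      · linarith
      · linarith
      · linarith
  choose! y hy hval using herr
  refine ⟨(∑ i ∈ Finset.range M, y i) / M, ⟨?_, ?_⟩, ?_⟩
  · rw [le_div_iff₀ hMpos, mul_comm]
    simpa using Finset.card_nsmul_le_sum (Finset.range M) y A fun i hi => (hy i hi).1
  · rw [div_le_iff₀ hMpos, mul_comm]
    simpa using Finset.sum_le_card_nsmul (Finset.range M) y B fun i hi => (hy i hi).2
  · rw [compositeError, compositeRule, ← hstep, ← hM, ← hsum, ← Finset.sum_sub_distrib,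
      Finset.sum_congr rfl hval, ← Finset.mul_sum, hMR, ← hMh, mul_pow]
    field_simp
    ring

end OverlapQuadrature

theorem mainTheorem3 (n N : ℕ) (hn : Odd n) (hN : n ≤ N) (a b : ℝ) (hab : a < b)
    (η : ℝ) (hη : 0 < η) (f : ℝ → ℝ)
    (hf : ContDiffOn ℝ ((n + 1 : ℕ) : WithTop ℕ∞) f (OverlapQuadrature.hull n N a b)) :
    ∃ ξ ∈ OverlapQuadrature.hull n N a b,
      OverlapQuadrature.compositeError n N a b f =
        OverlapQuadrature.normalizedError n η *
          ((b - a) ^ (n + 2) *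
              iteratedDerivWithin (n + 1) f (OverlapQuadrature.hull n N a b) ξ /
            ((N : ℝ) - ((n : ℝ) - 1)) ^ (n + 1)) := by
  set J := OverlapQuadrature.hull n N a b with hJ
  set g : ℝ → ℝ := iteratedDerivWithin (n + 1) f J with hg
  have hMpos : (0 : ℝ) < (N : ℝ) - ((n : ℝ) - 1) := by
    have : (n : ℝ) ≤ N := by exact_mod_cast hN
    linarith
  have hD : 0 ≤ max ((n : ℝ) - 2) 0 * OverlapQuadrature.step n N a b / 2 := by
    have : 0 < OverlapQuadrature.step n N a b := div_pos (by linarith) hMpos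
    positivity
  have hlt : a - max ((n : ℝ) - 2) 0 * OverlapQuadrature.step n N a b / 2 <
      b + max ((n : ℝ) - 2) 0 * OverlapQuadrature.step n N a b / 2 := by linarith
  have hJc : IsCompact J := isCompact_Icc
  have hJne : J.Nonempty := Set.nonempty_Icc.2 hlt.le
  have hJp : IsPreconnected J := isPreconnected_Icc
  have hgc : ContinuousOn g J :=
    hf.continuousOn_iteratedDerivWithin le_rfl (uniqueDiffOn_Icc hlt)
  obtain ⟨p, hp, hpmin⟩ := hJc.exists_isMinOn hJne hgc
  obtain ⟨q, hq, hqmax⟩ := hJc.exists_isMaxOn hJne hgc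
  obtain ⟨y, hy, hval⟩ := OverlapQuadrature.exists_compositeError_eq hn hN hab hf
    (fun x hx => ⟨hpmin hx, hqmax hx⟩)
  obtain ⟨ξ, hξ, rfl⟩ := hJp.intermediate_value hp hq hgc hy
  exact ⟨ξ, hξ, by rw [hval, OverlapQuadrature.normalizedError_eq hn hη]⟩
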